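/- Let $0<r<1$, $\alpha>0$, $\beta\in\mathbb R$. Let $L_1$ be the space of $2\pi$-periodic functions summable on $[0,2\pi)$, with $\|\varphi\|_1=\int_0^{2\pi}|\varphi(t)|\,dt$, and let $E_n(\varphi)_{L_1}=\inf_{T}\|\varphi-T\|_1$, the infimum being over all real trigonometric polynomials $T$ of order at most $n-1$. Let $C^{\alpha,r}_\beta L_1$ be the set of functions $f$ that are representable for all $x\in\mathbb R$ in the form $$f(x)=\frac{a_0}{2}+\frac1\pi\int_{-\pi}^{\pi}\Big(\sum_{k=1}^\infty e^{-\alpha k^r}\cos\big(k(x-t)-\tfrac{\beta\pi}{2}\big)\Big)\varphi(t)\,dt,\qquad a_0\in\mathbb R,\ \varphi\in L_1,\ \int_{-\pi}^{\pi}\varphi(t)\,dt=0;$$ the function $\varphi$ (determined up to a null set) is denoted by $f^{\alpha,r}_\beta$. For $n\in\mathbb N$ let $\tilde S_{n-1}(f;\cdot)$ be the trigonometric polynomial of order at most $n-1$ that coincides with $f$ at the points $x_k=\frac{2k\pi}{2n-1}$, $k=0,\dots,2n-2$; explicitly, $\tilde S_{n-1}(f;x)=\frac{2}{2n-1}\sum_{k=0}^{2n-2}f(x_k)D_{n-1}(x-x_k)$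 with $D_{n-1}(t)=\frac12+\sum_{k=1}^{n-1}\cos kt$. Let $n_*=n_*(\alpha,r,1)$ be the least $n\in\mathbb N=\{1,2,\dots\}$ such that $\frac{\ln \pi n}{\alpha r n^r}+\frac{\alpha r}{n^{1-r}}\le\frac1{14}$. Then for all $n\ge n_*$, all $x\in\mathbb R$ and all $f\in C^{\alpha,r}_\beta L_1$ there is a real number $\gamma^*$, depending only on $n,\alpha,r,\beta,f,x$, with $|\gamma^*|<20\pi^4$, such that $$|f(x)-\tilde S_{n-1}(f;x)|\le 2e^{-\alpha n^r}n^{1-r}\Big|\sin\frac{2n-1}{2}x\Big|\Big(\frac1{\pi\alpha r}+\gamma^*\Big(\frac{1}{(\alpha r)^2n^r}+\frac1{n^{1-r}}\Big)\Big)E_n(f^{\alpha,r}_\beta)_{L_1},$$ and, moreover, there is a function $\mathcal F\in C^{\alpha,r}_\beta L_1$ (depending on $f,n,x$) such that $E_n(\mathcal F^{\alpha,r}_\beta)_{L_1}=E_n(f^{\alpha,r}_\beta)_{L_1}$ and $$|\mathcal F(x)-\tilde S_{n-1}(\mathcal F;x)|= 2e^{-\alpha n^r}n^{1-r}\Big|\sin\frac{2n-1}{2}x\Big|\Big(\frac1{\pi\alpha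 r}+\gamma^*\Big(\frac{1}{(\alpha r)^2n^r}+\frac1{n^{1-r}}\Big)\Big)E_n(f^{\alpha,r}_\beta)_{L_1}.$$ -/

import Mathlib

open MeasureTheory Filter Topology

noncomputable section

/-- `φ` belongs to the space `L₁` of `2π`-periodic real functions summable on a period. -/
def IsPeriodicL1 (φ : ℝ → ℝ) : Prop :=
  Function.Periodic φ (2 * Real.pi) ∧ IntervalIntegrable φ volume 0 (2 * Real.pi)

/-- The generalized Poisson kernel
`P_{α,r,β}(t) = ∑_{k ≥ 1} e^{-α k^r} cos (k t - β π / 2)`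
(the summation index is shifted by one). -/
def genPoissonKernel (α r β t : ℝ) : ℝ :=
  ∑' k : ℕ, Real.exp (-α * ((k : ℝ) + 1) ^ r) *
    Real.cos (((k : ℝ) + 1) * t - β * Real.pi / 2)

/-- `f ∈ C^{α,r}_β L₁` with generalized derivative `f^{α,r}_β = φ`: the function `φ` lies in `L₁`,
is orthogonal to the constants, and `f` is at every point the sum of a constant and of
the convolution of `φ` with the generalized Poisson kernel. -/
structure IsGenDeriv (α r β : ℝ) (f φ : ℝ → ℝ) : Prop where
  memL1 : IsPeriodicL1 φ
  orthogonal : ∫ t in (-Real.pi)..Real.pi, φ t = 0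
  repr : ∃ a₀ : ℝ, ∀ x : ℝ, f x = a₀ / 2 +
    (1 / Real.pi) * ∫ t in (-Real.pi)..Real.pi, genPoissonKernel α r β (x - t) * φ t

/-- The set `C^{α,r}_β L₁` of generalized Poisson integrals of functions of `L₁`. -/
def poissonClassL1 (α r β : ℝ) : Set (ℝ → ℝ) := {f | ∃ φ, IsGenDeriv α r β f φ}

/-- Real trigonometric polynomials of order at most `m`. -/
def trigPoly (m : ℕ) : Set (ℝ → ℝ) :=
  {T | ∃ a b : ℕ → ℝ, ∀ t, T t =
    ∑ k ∈ Finset.range (m + 1), (a k * Real.cos (k * t) + b k * Real.sin (k * t))}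

/-- The best approximation `E_n(φ)_{L₁}` of `φ` in the `L₁`-metric by trigonometric
polynomials of order at most `n - 1` (used for `n ≥ 1`). -/
def bestApproxL1 (n : ℕ) (φ : ℝ → ℝ) : ℝ :=
  ⨅ T : trigPoly (n - 1), ∫ t in (0 : ℝ)..(2 * Real.pi), |φ t - (T : ℝ → ℝ) t|

/-- The Dirichlet kernel `D_m(t) = 1/2 + ∑_{k=1}^m cos (k t)`. -/
def dirichletKernel (m : ℕ) (t : ℝ) : ℝ :=
  1 / 2 + ∑ k ∈ Finset.Icc 1 m, Real.cos (k * t)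

/-- The interpolation node `x_k^{(n-1)} = 2 k π / (2 n - 1)`. -/
def node (n k : ℕ) : ℝ := 2 * k * Real.pi / (2 * n - 1)

/-- The Lagrange trigonometric interpolation polynomial `S̃_{n-1}(f; x)` of order `n - 1`
with the `2 n - 1` equidistant nodes `x_k^{(n-1)}`, `0 ≤ k ≤ 2 n - 2` (used for `n ≥ 1`). -/
def lagrangeInterp (n : ℕ) (f : ℝ → ℝ) (x : ℝ) : ℝ :=
  2 / (2 * n - 1) *
    ∑ k ∈ Finset.range (2 * n - 1), f (node n k) * dirichletKernel (n - 1) (x - node n k)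

/-- The natural numbers `n ≥ 1` with `ln (π n) / (α r n^r) + α r / n^{1-r} ≤ 1/14`. -/
def nStarSet (α r : ℝ) : Set ℕ :=
  {n | 1 ≤ n ∧ Real.log (Real.pi * n) / (α * r * (n : ℝ) ^ r) +
    α * r / (n : ℝ) ^ (1 - r) ≤ 1 / 14}

/-- `n_*(α, r, 1)`: the least element of `nStarSet α r`. -/
def nStar (α r : ℝ) : ℕ := sInf (nStarSet α r)

theorem nStar_isLeast {α r : ℝ} (hr0 : 0 < r) (hr1 : r < 1) :
    IsLeast (nStarSet α r) (nStar α r) := by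
  have hne : (nStarSet α r).Nonempty := by
    have h1 : Tendsto (fun y : ℝ => Real.log (Real.pi * y) / (α * r * y ^ r)) atTop (𝓝 0) := by
      have e1 : Tendsto (fun y : ℝ => Real.log y / y ^ r) atTop (𝓝 0) :=
        (isLittleO_log_rpow_atTop hr0).tendsto_div_nhds_zero
      have e2 : Tendsto (fun y : ℝ => Real.log Real.pi / y ^ r) atTop (𝓝 0) :=
        (tendsto_rpow_atTop hr0).const_div_atTop _
      have e3 := (e2.add e1).div_const (α * r)
      rw [add_zero, zero_div] at e3
      refine e3.congr' ?_
      filter_upwards [eventually_gt_atTop 0] with y hy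
      rw [Real.log_mul Real.pi_pos.ne' hy.ne', ← add_div, div_div, mul_comm (y ^ r)]
    have h2 : Tendsto (fun y : ℝ => α * r / y ^ (1 - r)) atTop (𝓝 0) :=
      (tendsto_rpow_atTop (by linarith)).const_div_atTop _
    have h3 := (h1.add h2).comp tendsto_natCast_atTop_atTop
    rw [add_zero] at h3
    obtain ⟨n, hn, hn1⟩ :=
      ((h3.eventually_le_const (by norm_num : (0 : ℝ) < 1 / 14)).and
        (eventually_ge_atTop 1)).exists
    exact ⟨n, hn1, hn⟩
  exact ⟨Nat.sInf_mem hne, fun m hm => Nat.sInf_le hm⟩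

theorem two_sin_mul_dirichletKernel (m : ℕ) (t : ℝ) :
    2 * Real.sin (t / 2) * dirichletKernel m t = Real.sin ((m + 1 / 2) * t) := by
  induction m with
  | zero => simp [dirichletKernel]; ring_nf
  | succ m ih =>
    have h : dirichletKernel (m + 1) t = dirichletKernel m t + Real.cos ((m + 1 : ℕ) * t) := by
      simp only [dirichletKernel]
      rw [Finset.sum_Icc_succ_top (by omega)]; ring
    rw [h, mul_add, ih]
    have e1 : ((m : ℝ) + 1 / 2) * t = (m + 1) * t - t / 2 := by ring
    have e2 : (((m + 1 : ℕ) : ℝ) + 1 / 2) * t = (m + 1) * t + t / 2 := by push_cast; ring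
    rw [e1, e2, Real.sin_add, Real.sin_sub]; push_cast; ring

/-- `S̃_{n-1}(f; ·)` is a trigonometric polynomial of order at most `n - 1`. -/
theorem lagrangeInterp_mem (n : ℕ) (f : ℝ → ℝ) : lagrangeInterp n f ∈ trigPoly (n - 1) := by
  refine ⟨fun k => 2 / (2 * n - 1) * ∑ j ∈ Finset.range (2 * n - 1),
    f (node n j) * ((if k = 0 then 1 / 2 else 1) * Real.cos (k * node n j)),
    fun k => 2 / (2 * n - 1) * ∑ j ∈ Finset.range (2 * n - 1),
    f (node n j) * ((if k = 0 then 1 / 2 else 1) * Real.sin (k * node n j)), fun t => ?_⟩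
  have hD : ∀ s : ℝ, dirichletKernel (n - 1) s =
      ∑ k ∈ Finset.range (n - 1 + 1), (if k = 0 then 1 / 2 else 1) * Real.cos (k * s) := by
    intro s
    rw [Finset.range_eq_Ico, Finset.sum_eq_sum_Ico_succ_bot (by omega)]
    simp only [dirichletKernel]
    congr 1
    · simp
    · refine Finset.sum_congr (by ext; simp only [Finset.mem_Icc, Finset.mem_Ico]; omega) fun k hk => ?_
      have : k ≠ 0 := by simp at hk; omega
      simp [this]
  simp only [lagrangeInterp, hD, Finset.mul_sum, Finset.sum_mul]
  rw [Finset.sum_comm]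
  refine Finset.sum_congr rfl fun k _ => ?_
  rw [← Finset.sum_add_distrib]
  refine Finset.sum_congr rfl fun j _ => ?_
  rw [mul_sub, Real.cos_sub]; ring

/-- `S̃_{n-1}(f; ·)` interpolates `f` at the nodes. -/
theorem lagrangeInterp_node {n : ℕ} (hn : 1 ≤ n) (f : ℝ → ℝ) {i : ℕ} (hi : i < 2 * n - 1) :
    lagrangeInterp n f (node n i) = f (node n i) := by
  have hN : (0 : ℝ) < 2 * n - 1 := by
    have : (1 : ℝ) ≤ n := by exact_mod_cast hn
    linarith
  rw [lagrangeInterp, Finset.sum_eq_single i]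
  · simp only [sub_self, dirichletKernel, mul_zero, Real.cos_zero, Finset.sum_const, Nat.card_Icc]
    rw [nsmul_eq_mul]
    have : ((n - 1 + 1 - 1 : ℕ) : ℝ) = n - 1 := by
      rw [Nat.add_sub_cancel, Nat.cast_sub hn]; simp
    rw [this]; field_simp
    ring
  · intro j hj hji
    have hj : j < 2 * n - 1 := by simpa using hj
    have key := two_sin_mul_dirichletKernel (n - 1) (node n i - node n j)
    have hs : ((n - 1 : ℕ) + 1 / 2 : ℝ) * (node n i - node n j) = ((i - j : ℤ) : ℝ) * Real.pi := by
      rw [Nat.cast_sub hn]; simp only [node]; push_cast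
      have hN' := hN.ne'
      generalize hM : (2 * (n : ℝ) - 1) = M at hN'
      have hn' : (n : ℝ) = (M + 1) / 2 := by linarith
      rw [hn']; field_simp; ring
    rw [hs, Real.sin_int_mul_pi] at key
    have hne : Real.sin ((node n i - node n j) / 2) ≠ 0 := by
      rw [Real.sin_ne_zero_iff]
      intro z hz
      have h2 : (z : ℝ) * (2 * n - 1) = (i : ℝ) - j := by
        have h3 := hz
        simp only [node] at h3
        field_simp at h3
        linarith
      have h4 : z * (2 * (n : ℤ) - 1) = i - j := by exact_mod_cast h2
      have h5 : (2 * (n : ℤ) - 1) ∣ (i - j) := ⟨z, by rw [← h4]; ring⟩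
      have h6 := Int.eq_zero_of_abs_lt_dvd h5 (by rw [abs_lt]; omega)
      omega
    have : dirichletKernel (n - 1) (node n i - node n j) = 0 := by
      rcases mul_eq_zero.1 key with h | h
      · exact absurd h (by simpa using hne)
      · exact h
    rw [this, mul_zero]
  · intro h; exact absurd (Finset.mem_range.2 hi) h

end

/-! Write w = α r n^r. The interpolation error at x is (1/π) ∫ K φ, where K is `interpErrorKernel`.
Interpolation reproduces harmonics of order below n and aliases the others modulo 2n - 1, so K(t) =
∑_{j≥0} e^{-α(n+j)^r} h_j(t), with h_j the function `aliasHarmonic`. Each h_j has frequency n + j in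
t. Hence K is orthogonal to polynomials of order at most n - 1, and the error is at most (1/π) ‖K‖_∞
E_n(φ) (`IsGenDeriv.abs_sub_lagrangeInterp_le`). A narrow bump at a point where |K| is nearly
maximal shows that this bound is almost attained (`exists_isGenDeriv_le_abs_sub_lagrangeInterp`).

It remains to find ‖K‖_∞ up to lower order terms. From above, |h_j| ≤ 2 |sin((2n-1)x/2)| (1 + j/n),
and the weighted coefficient sum is at most e^{-αn^r} (1 + n/(w-2)). From below, at one suitable
point all h_j, with a common sign, are at least 2 |sin((2n-1)x/2)| (1 - 4j/n), and the plain
coefficient sum is at least e^{-αn^r} n/w. Both bounds have main term n/w and remainder O(1 + n/w²),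
which is the form required.

Finally F is taken to be f or a bump function, with error at least that of f and at least the lower
bound. The number γ is defined by the required equality for F, and the two bounds confine it. -/

noncomputable section

/-! ### Sums of the coefficients of the kernel -/

/-- The convex function ρ ↦ ρ^(-p) lies above its tangent at ρ = 1. -/
theorem one_add_mul_one_sub_le_rpow_neg {ρ p : ℝ} (hρ : 0 < ρ) (hp : 0 ≤ p) :
    1 + p * (1 - ρ) ≤ ρ ^ (-p) := by
  rw [Real.rpow_def_of_pos hρ]
  have h1 := Real.add_one_le_exp (Real.log ρ * -p)
  have h2 := Real.log_le_sub_one_of_pos hρ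
  nlinarith

/-- Integral comparison for u^(-(p+1)) on [y, y + 1/ν], obtained without integrals from the tangent
bound at ρ = y / (y + 1/ν). -/
theorem rpow_neg_le_telescope {ν p y : ℝ} (hν : 0 < ν) (hp : 0 < p) (hy : 0 < y) :
    (y + 1 / ν) ^ (-(p + 1)) ≤ ν / p * (y ^ (-p) - (y + 1 / ν) ^ (-p)) := by
  set z := y + 1 / ν with hz
  have hν' : 0 < 1 / ν := by positivity
  have hz0 : 0 < z := by positivity
  have h1 := one_add_mul_one_sub_le_rpow_neg (div_pos hy hz0) hp.le
  rw [Real.div_rpow hy.le hz0.le] at h1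
  have hzp : 0 < z ^ (-p) := Real.rpow_pos_of_pos hz0 _
  rw [le_div_iff₀ hzp] at h1
  have h2 : 1 - y / z = 1 / (ν * z) := by
    rw [eq_div_iff (by positivity), sub_mul]
    field_simp
    rw [hz]; field_simp; ring
  rw [h2] at h1
  have h3 : z ^ (-(p + 1)) = z ^ (-p) / z := by
    rw [neg_add, Real.rpow_add hz0, Real.rpow_neg_one]; rfl
  rw [h3]
  calc z ^ (-p) / z = ν / p * ((1 + p * (1 / (ν * z))) * z ^ (-p) - z ^ (-p)) := by
        field_simp; ring
    _ ≤ _ := by gcongr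

theorem sum_range_rpow_neg_le {ν p : ℝ} (hν : 0 < ν) (hp : 0 < p) (M : ℕ) :
    ∑ j ∈ Finset.range M, (1 + (j : ℝ) / ν) ^ (-(p + 1)) ≤ 1 + ν / p := by
  -- The subtracted term is the telescoping remainder; the induction does not close without it.
  have key : ∀ M : ℕ, ∑ j ∈ Finset.range (M + 1), (1 + (j : ℝ) / ν) ^ (-(p + 1)) ≤
      1 + ν / p * (1 - (1 + (M : ℝ) / ν) ^ (-p)) := by
    intro M
    induction M with
    | zero => simp
    | succ M ih =>
      rw [Finset.sum_range_succ]
      have h := rpow_neg_le_telescope (y := 1 + (M : ℝ) / ν) hν hp (by positivity)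
      have e : 1 + ((M + 1 : ℕ) : ℝ) / ν = 1 + (M : ℝ) / ν + 1 / ν := by push_cast; ring
      rw [e]
      linarith
  have hpos : ∀ j : ℕ, 0 ≤ (1 + (j : ℝ) / ν) ^ (-(p + 1)) := fun j => by positivity
  have h1 : 0 ≤ ν / p * (1 + (M : ℝ) / ν) ^ (-p) := by positivity
  have h2 := key M
  rw [Finset.sum_range_succ] at h2
  have := hpos M
  linarith

section Coefficients

variable {α r : ℝ} {n : ℕ}

/-- With u = 1 + j/n, the bound u^r ≥ 1 + r log u turns the exponential into e^{-αn^r} u^{-w}. The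
weight u raises the exponent to 1 - w = -(p + 1) with p = w - 2, which is why w > 2 is needed for
summation. -/
theorem exp_neg_rpow_mul_le (hα : 0 < α) (hn : 1 ≤ n) (j : ℕ) :
    Real.exp (-α * ((n : ℝ) + j) ^ r) * (1 + (j : ℝ) / n) ≤
      Real.exp (-α * (n : ℝ) ^ r) *
        (1 + (j : ℝ) / n) ^ (-((α * r * (n : ℝ) ^ r - 2) + 1)) := by
  have hn0 : (0 : ℝ) < n := by exact_mod_cast hn
  set u : ℝ := 1 + (j : ℝ) / n with hu
  have hu0 : 0 < u := by positivity
  have e1 : (n : ℝ) + j = n * u := by rw [hu]; field_simp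
  have hnr : 0 < (n : ℝ) ^ r := Real.rpow_pos_of_pos hn0 _
  rw [e1, Real.mul_rpow hn0.le hu0.le]
  have h1 : 1 + r * Real.log u ≤ u ^ r := by
    rw [Real.rpow_def_of_pos hu0]
    linarith [Real.add_one_le_exp (Real.log u * r)]
  have e2 : u ^ (-((α * r * (n : ℝ) ^ r - 2) + 1)) =
      Real.exp (-(α * r * (n : ℝ) ^ r) * Real.log u) * u := by
    rw [show -((α * r * (n : ℝ) ^ r - 2) + 1) = -(α * r * (n : ℝ) ^ r) + 1 by ring,
      Real.rpow_add hu0, Real.rpow_one, Real.rpow_def_of_pos hu0, mul_comm (Real.log u)]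
  rw [e2, ← mul_assoc (Real.exp (-α * (n : ℝ) ^ r)), ← Real.exp_add]
  gcongr
  have := mul_le_mul_of_nonneg_left h1 (mul_pos hα hnr).le
  linarith

theorem summable_exp_neg_rpow_mul (hα : 0 < α) (hn : 1 ≤ n) (hw : 2 < α * r * (n : ℝ) ^ r) :
    Summable (fun j : ℕ => Real.exp (-α * ((n : ℝ) + j) ^ r) * (1 + (j : ℝ) / n)) ∧
    ∑' j : ℕ, Real.exp (-α * ((n : ℝ) + j) ^ r) * (1 + (j : ℝ) / n) ≤
      Real.exp (-α * (n : ℝ) ^ r) * (1 + n / (α * r * (n : ℝ) ^ r - 2)) := by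
  have hn0 : (0 : ℝ) < n := by exact_mod_cast hn
  have hb : ∀ M : ℕ, ∑ j ∈ Finset.range M,
      Real.exp (-α * ((n : ℝ) + j) ^ r) * (1 + (j : ℝ) / n) ≤
      Real.exp (-α * (n : ℝ) ^ r) * (1 + n / (α * r * (n : ℝ) ^ r - 2)) := by
    intro M
    refine (Finset.sum_le_sum fun j _ => exp_neg_rpow_mul_le hα hn j).trans ?_
    rw [← Finset.mul_sum]
    gcongr
    exact sum_range_rpow_neg_le hn0 (by linarith) M
  have h0 : ∀ j : ℕ, 0 ≤ Real.exp (-α * ((n : ℝ) + j) ^ r) * (1 + (j : ℝ) / n) :=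
    fun j => by positivity
  exact ⟨summable_of_sum_range_le h0 hb, Real.tsum_le_of_sum_range_le h0 hb⟩

theorem summable_exp_neg_rpow (hα : 0 < α) (hn : 1 ≤ n) (hw : 2 < α * r * (n : ℝ) ^ r) :
    Summable (fun j : ℕ => Real.exp (-α * ((n : ℝ) + j) ^ r)) := by
  refine Summable.of_nonneg_of_le (fun j => (Real.exp_pos _).le) (fun j => ?_)
    (summable_exp_neg_rpow_mul hα hn hw).1
  exact le_mul_of_one_le_right (Real.exp_pos _).le (by
    have : (0 : ℝ) ≤ (j : ℝ) / n := by positivity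
    linarith)

/-- Concavity, (1 + s)^r ≤ 1 + r s, gives a geometric minorant of ratio e^{-q} with q = w/n, and
1/(1 - e^{-q}) ≥ 1/q. -/
theorem le_tsum_exp_neg_rpow (hα : 0 < α) (hr0 : 0 < r) (hr1 : r < 1) (hn : 1 ≤ n)
    (hw : 2 < α * r * (n : ℝ) ^ r) :
    Real.exp (-α * (n : ℝ) ^ r) * (n / (α * r * (n : ℝ) ^ r)) ≤
      ∑' j : ℕ, Real.exp (-α * ((n : ℝ) + j) ^ r) := by
  have hn0 : (0 : ℝ) < n := by exact_mod_cast hn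
  have hnr : 0 < (n : ℝ) ^ r := Real.rpow_pos_of_pos hn0 _
  set q : ℝ := α * r * (n : ℝ) ^ r / n with hq
  have hq0 : 0 < q := by positivity
  have he1 : Real.exp (-q) < 1 := Real.exp_lt_one_iff.mpr (by linarith)
  have hg := hasSum_geometric_of_lt_one (Real.exp_pos (-q)).le he1
  have hle : ∀ j : ℕ, Real.exp (-α * (n : ℝ) ^ r) * Real.exp (-q) ^ j ≤
      Real.exp (-α * ((n : ℝ) + j) ^ r) := by
    intro j
    rw [← Real.exp_nat_mul, ← Real.exp_add]
    have e1 : (n : ℝ) + j = n * (1 + (j : ℝ) / n) := by field_simp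
    rw [e1, Real.mul_rpow hn0.le (by positivity)]
    have h0 : (0 : ℝ) ≤ (j : ℝ) / n := by positivity
    have h1 := rpow_one_add_le_one_add_mul_self (s := (j : ℝ) / n) (p := r) (by linarith)
      hr0.le hr1.le
    have := mul_le_mul_of_nonneg_left h1 (mul_pos hα hnr).le
    refine Real.exp_le_exp.2 ?_
    have e2 : (j : ℝ) * -q = -(α * (n : ℝ) ^ r * (r * ((j : ℝ) / n))) := by rw [hq]; ring
    rw [e2]; linarith
  have h1 := Summable.tsum_le_tsum hle (hg.summable.mul_left _) (summable_exp_neg_rpow hα hn hw)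
  rw [tsum_mul_left, hg.tsum_eq] at h1
  refine le_trans ?_ h1
  gcongr
  have e3 : (n : ℝ) / (α * r * (n : ℝ) ^ r) = q⁻¹ := by rw [hq, inv_div]
  rw [e3]
  refine inv_anti₀ (by linarith) ?_
  linarith [Real.add_one_le_exp (-q)]

end Coefficients

/-! ### Interpolation of a single harmonic -/

/-- Multiplication by 2 sin(dπ/(2n-1)), nonzero because 2n - 1 does not divide d, makes the sum
telescope over whole periods. -/
theorem sum_cos_node_eq_zero {n : ℕ} (hn : 1 ≤ n) {d : ℤ} (hd : ¬ (2 * (n : ℤ) - 1) ∣ d) (c : ℝ) :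
    ∑ j ∈ Finset.range (2 * n - 1), Real.cos (d * node n j + c) = 0 := by
  have hN : (0 : ℝ) < 2 * n - 1 := by
    have : (1 : ℝ) ≤ n := by exact_mod_cast hn
    linarith
  have hne : Real.sin (d * Real.pi / (2 * n - 1)) ≠ 0 := by
    rw [Real.sin_ne_zero_iff]
    intro z hz
    apply hd
    refine ⟨z, ?_⟩
    have h2 : (d : ℝ) = (2 * n - 1) * z := by
      rw [eq_div_iff hN.ne'] at hz
      have := mul_right_cancel₀ Real.pi_pos.ne'
        (show (z : ℝ) * (2 * n - 1) * Real.pi = d * Real.pi by linarith)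
      linarith
    exact_mod_cast h2
  have hstep : ∀ j : ℕ, 2 * Real.sin (d * Real.pi / (2 * n - 1)) * Real.cos (d * node n j + c) =
      Real.sin (d * Real.pi * (2 * (j + 1 : ℕ) - 1) / (2 * n - 1) + c) -
      Real.sin (d * Real.pi * (2 * (j : ℕ) - 1) / (2 * n - 1) + c) := by
    intro j
    have e1 : d * Real.pi * (2 * (j + 1 : ℕ) - 1) / (2 * n - 1) + c =
        (d * node n j + c) + d * Real.pi / (2 * n - 1) := by
      simp only [node]; push_cast; field_simp; ring
    have e2 : d * Real.pi * (2 * (j : ℕ) - 1) / (2 * n - 1) + c =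
        (d * node n j + c) - d * Real.pi / (2 * n - 1) := by
      simp only [node]; field_simp; ring
    rw [e1, e2, Real.sin_add, Real.sin_sub]; ring
  have hsum : 2 * Real.sin (d * Real.pi / (2 * n - 1)) *
      ∑ j ∈ Finset.range (2 * n - 1), Real.cos (d * node n j + c) = 0 := by
    rw [Finset.mul_sum, Finset.sum_congr rfl fun j _ => hstep j,
      Finset.sum_range_sub (fun j : ℕ =>
        Real.sin (d * Real.pi * (2 * (j : ℕ) - 1) / (2 * n - 1) + c))]
    have e3 : ((2 * n - 1 : ℕ) : ℝ) = 2 * n - 1 := by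
      rw [Nat.cast_sub (by omega)]; push_cast; ring
    have e4 : d * Real.pi * (2 * ((2 * n - 1 : ℕ) : ℝ) - 1) / (2 * n - 1) + c =
        d * Real.pi * (2 * ((0 : ℕ) : ℝ) - 1) / (2 * n - 1) + c + d * (2 * Real.pi) := by
      rw [e3]; push_cast; field_simp; ring
    rw [e4, Real.sin_add_int_mul_two_pi, sub_self]
  rcases mul_eq_zero.1 hsum with h | h
  · exact absurd h (by simpa using hne)
  · exact h

/-- Discrete orthogonality: for k, l < n the frequencies k ± l are smaller than 2n - 1 in modulus,
so only l = k survives. The case k = 0 is carried by the term 1/2 of the Dirichlet kernel. -/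
theorem lagrangeInterp_cos_nat {n : ℕ} (hn : 1 ≤ n) {k : ℕ} (hk : k < n) (c x : ℝ) :
    lagrangeInterp n (fun y => Real.cos (k * y + c)) x = Real.cos (k * x + c) := by
  have hN : (0 : ℝ) < 2 * n - 1 := by
    have : (1 : ℝ) ≤ n := by exact_mod_cast hn
    linarith
  have hcard : ((2 * n - 1 : ℕ) : ℝ) = 2 * n - 1 := by
    rw [Nat.cast_sub (by omega)]; push_cast; ring
  have hnd : ∀ d : ℤ, d ≠ 0 → |d| < 2 * n - 1 → ¬ (2 * (n : ℤ) - 1) ∣ d := fun d h0 h1 h2 =>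
    h0 (Int.eq_zero_of_abs_lt_dvd h2 h1)
  have hprod : ∀ l ∈ Finset.Icc 1 (n - 1), ∑ j ∈ Finset.range (2 * n - 1),
      Real.cos (k * node n j + c) * Real.cos (l * (x - node n j)) =
      if l = k then (2 * n - 1) / 2 * Real.cos (k * x + c) else 0 := by
    intro l hl
    rw [Finset.mem_Icc] at hl
    have e : ∀ j : ℕ, Real.cos (k * node n j + c) * Real.cos (l * (x - node n j)) =
        1 / 2 * Real.cos (((k - l : ℤ) : ℝ) * node n j + (c + l * x)) +
        1 / 2 * Real.cos (((k + l : ℤ) : ℝ) * node n j + (c - l * x)) := by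
      intro j
      have e1 : ((k - l : ℤ) : ℝ) * node n j + (c + l * x) =
        (k * node n j + c) + (l * (x - node n j)) := by push_cast; ring
      have e2 : ((k + l : ℤ) : ℝ) * node n j + (c - l * x) =
        (k * node n j + c) - (l * (x - node n j)) := by push_cast; ring
      rw [e1, e2, Real.cos_add (k * node n j + c), Real.cos_sub (k * node n j + c)]; ring
    rw [Finset.sum_congr rfl fun j _ => e j, Finset.sum_add_distrib, ← Finset.mul_sum,
      ← Finset.mul_sum, sum_cos_node_eq_zero hn (d := (k + l : ℤ))
        (hnd _ (by omega) (by rw [abs_lt]; omega))]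
    split_ifs with h
    · subst h
      simp only [sub_self, Int.cast_zero, zero_mul, zero_add, Finset.sum_const, Finset.card_range,
        nsmul_eq_mul, hcard]
      rw [add_comm c]; ring
    · rw [sum_cos_node_eq_zero hn (hnd _ (by omega) (by rw [abs_lt]; omega))]; ring
  have hzero : ∑ j ∈ Finset.range (2 * n - 1), Real.cos (k * node n j + c) =
      if k = 0 then (2 * n - 1) * Real.cos (k * x + c) else 0 := by
    split_ifs with h
    · subst h; simp [hcard]
    · exact sum_cos_node_eq_zero hn (d := (k : ℤ)) (hnd _ (by omega) (by rw [abs_lt]; omega)) c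
  have hsplit : ∑ j ∈ Finset.range (2 * n - 1),
      Real.cos (k * node n j + c) * dirichletKernel (n - 1) (x - node n j) =
      1 / 2 * ∑ j ∈ Finset.range (2 * n - 1), Real.cos (k * node n j + c) +
      ∑ l ∈ Finset.Icc 1 (n - 1), ∑ j ∈ Finset.range (2 * n - 1),
        Real.cos (k * node n j + c) * Real.cos (l * (x - node n j)) := by
    rw [Finset.sum_comm, Finset.mul_sum, ← Finset.sum_add_distrib]
    refine Finset.sum_congr rfl fun j _ => ?_
    rw [dirichletKernel, ← Finset.mul_sum]; ring
  rw [lagrangeInterp, hsplit, Finset.sum_congr rfl hprod, hzero, Finset.sum_ite_eq']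
  have hmem : k ∈ Finset.Icc 1 (n - 1) ↔ k ≠ 0 := by rw [Finset.mem_Icc]; omega
  by_cases h0 : k = 0
  · rw [if_pos h0, if_neg (by rw [hmem]; exact not_not.2 h0)]; field_simp; ring
  · rw [if_neg h0, if_pos (hmem.2 h0)]; field_simp; ring

theorem lagrangeInterp_cos_int {n : ℕ} (hn : 1 ≤ n) {k : ℤ} (hk : |k| < n) (c x : ℝ) :
    lagrangeInterp n (fun y => Real.cos (k * y + c)) x = Real.cos (k * x + c) := by
  rw [abs_lt] at hk
  rcases Int.eq_nat_or_neg k with ⟨m, rfl | rfl⟩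
  · exact_mod_cast lagrangeInterp_cos_nat hn (k := m) (by omega) c x
  · have e : ∀ y : ℝ, Real.cos (((-(m : ℤ) : ℤ) : ℝ) * y + c) = Real.cos (m * y + -c) := by
      intro y
      rw [← Real.cos_neg]
      congr 1
      push_cast; ring
    simp only [e]
    exact lagrangeInterp_cos_nat hn (by omega) (-c) x

/-- Aliasing: at the nodes a harmonic coincides with its residue modulo `2 n - 1`. -/
theorem lagrangeInterp_cos_alias {n : ℕ} (hn : 1 ≤ n) {k : ℤ} (hk : |k| < n) (m : ℤ) (c x : ℝ) :
    lagrangeInterp n (fun y => Real.cos ((k + m * (2 * n - 1)) * y + c)) x =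
      Real.cos (k * x + c) := by
  rw [← lagrangeInterp_cos_int hn hk c x]
  have hN : (0 : ℝ) < 2 * n - 1 := by
    have : (1 : ℝ) ≤ n := by exact_mod_cast hn
    linarith
  simp only [lagrangeInterp]
  congr 1
  refine Finset.sum_congr rfl fun j _ => ?_
  congr 1
  have e : ((k : ℝ) + m * (2 * n - 1)) * node n j + c =
      k * node n j + c + ((m * j : ℤ) : ℝ) * (2 * Real.pi) := by
    simp only [node]; push_cast; field_simp; ring
  rw [e, Real.cos_add_int_mul_two_pi]

/-! ### The kernel of the interpolation error -/

theorem abs_sin_nat_mul_le (m : ℕ) (y : ℝ) : |Real.sin (m * y)| ≤ m * |Real.sin y| := by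
  induction m with
  | zero => simp
  | succ m ih =>
    have e : ((m + 1 : ℕ) : ℝ) * y = m * y + y := by push_cast; ring
    rw [e, Real.sin_add]
    refine (abs_add_le _ _).trans ?_
    rw [abs_mul, abs_mul]
    have h1 := Real.abs_cos_le_one y
    have h2 := Real.abs_cos_le_one (m * y)
    have h3 := mul_le_mul_of_nonneg_left h1 (abs_nonneg (Real.sin (m * y)))
    have h4 := mul_le_mul_of_nonneg_right h2 (abs_nonneg (Real.sin y))
    push_cast
    linarith

/-- The difference of the harmonic `cos ((n + j) (x - t) - β π / 2)` and its interpolant in `x`. -/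
def aliasHarmonic (β : ℝ) (n : ℕ) (x : ℝ) (j : ℕ) (t : ℝ) : ℝ :=
  Real.cos (((n : ℝ) + j) * (x - t) - β * Real.pi / 2) -
    Real.cos ((((j % (2 * n - 1) : ℕ) : ℝ) - (n - 1)) * x - ((n : ℝ) + j) * t - β * Real.pi / 2)

theorem natCast_eq_mod_add_div {n : ℕ} (hn : 1 ≤ n) (j : ℕ) :
    (j : ℝ) = ((j % (2 * n - 1) : ℕ) : ℝ) + ((j / (2 * n - 1) : ℕ) : ℝ) * (2 * n - 1) := by
  have h := Nat.mod_add_div j (2 * n - 1)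
  have hcard : ((2 * n - 1 : ℕ) : ℝ) = 2 * n - 1 := by
    rw [Nat.cast_sub (by omega)]; push_cast; ring
  rw [← hcard]
  conv_lhs => rw [← h]
  push_cast; ring

/-- Here n + j = k + m(2n - 1) with k = (j mod (2n-1)) - (n - 1), so that |k| < n, and m = 1 +
⌊j/(2n-1)⌋. -/
theorem cos_sub_lagrangeInterp_cos {n : ℕ} (hn : 1 ≤ n) (β x : ℝ) (j : ℕ) (t : ℝ) :
    Real.cos (((n : ℝ) + j) * (x - t) - β * Real.pi / 2) -
      lagrangeInterp n (fun y => Real.cos (((n : ℝ) + j) * (y - t) - β * Real.pi / 2)) x =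
      aliasHarmonic β n x j t := by
  have hmod : j % (2 * n - 1) < 2 * n - 1 := Nat.mod_lt _ (by omega)
  have key := lagrangeInterp_cos_alias hn (k := ((j % (2 * n - 1) : ℕ) : ℤ) - (n - 1))
    (by rw [abs_lt]; omega) (1 + ((j / (2 * n - 1) : ℕ) : ℤ))
    (-(((n : ℝ) + j) * t) - β * Real.pi / 2) x
  have hj := natCast_eq_mod_add_div hn j
  have e : ∀ y : ℝ, ((n : ℝ) + j) * (y - t) - β * Real.pi / 2 =
      ((((((j % (2 * n - 1) : ℕ) : ℤ) - (n - 1) : ℤ) : ℝ) +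
        ((1 + ((j / (2 * n - 1) : ℕ) : ℤ) : ℤ) : ℝ) * (2 * n - 1)) * y +
        (-(((n : ℝ) + j) * t) - β * Real.pi / 2)) := by
    intro y
    simp only [Int.cast_sub, Int.cast_natCast, Int.cast_one, Int.cast_add]
    have : ((j % (2 * n - 1) : ℕ) : ℝ) - (n - 1) +
        (1 + ((j / (2 * n - 1) : ℕ) : ℝ)) * (2 * n - 1) = n + j := by linarith
    rw [this]; ring
  rw [aliasHarmonic]
  congr 1
  simp only [e]
  rw [key]
  congr 1
  simp only [Int.cast_sub, Int.cast_natCast, Int.cast_one]; ring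

/-- The two phases differ by m(2n-1)x, m = 1 + ⌊j/(2n-1)⌋. The sine of half of this yields the
factor |sin((2n-1)x/2)| through |sin(m y)| ≤ m |sin y|. -/
theorem aliasHarmonic_eq_mul {n : ℕ} (hn : 1 ≤ n) (β x : ℝ) (j : ℕ) (t : ℝ) :
    aliasHarmonic β n x j t =
      -2 * Real.sin (((1 + j / (2 * n - 1) : ℕ) : ℝ) * ((2 * n - 1) / 2 * x)) *
        Real.sin (((n : ℝ) + j) * (x - t) - β * Real.pi / 2 -
          ((1 + j / (2 * n - 1) : ℕ) : ℝ) * ((2 * n - 1) / 2 * x)) := by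
  have hj := natCast_eq_mod_add_div hn j
  have e : (((j % (2 * n - 1) : ℕ) : ℝ) - (n - 1)) * x - ((n : ℝ) + j) * t - β * Real.pi / 2 =
      ((n : ℝ) + j) * (x - t) - β * Real.pi / 2 -
        2 * (((1 + j / (2 * n - 1) : ℕ) : ℝ) * ((2 * n - 1) / 2 * x)) := by
    have : ((j % (2 * n - 1) : ℕ) : ℝ) = j - ((j / (2 * n - 1) : ℕ) : ℝ) * (2 * n - 1) := by
      linarith
    rw [this]
    generalize ((j / (2 * n - 1) : ℕ)) = m
    push_cast; ring
  rw [aliasHarmonic, e, Real.cos_sub_cos]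
  generalize ((n : ℝ) + j) * (x - t) - β * Real.pi / 2 = A
  generalize ((1 + j / (2 * n - 1) : ℕ) : ℝ) * ((2 * n - 1) / 2 * x) = B
  rw [show (A + (A - 2 * B)) / 2 = A - B by ring, show (A - (A - 2 * B)) / 2 = B by ring]
  ring

theorem one_add_div_le {n : ℕ} (hn : 1 ≤ n) (j : ℕ) :
    ((1 + j / (2 * n - 1) : ℕ) : ℝ) ≤ 1 + (j : ℝ) / n := by
  have hn0 : (0 : ℝ) < n := by exact_mod_cast hn
  have h : j / (2 * n - 1) ≤ j / n := Nat.div_le_div_left (by omega) (by omega)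
  have h2 : ((j / n : ℕ) : ℝ) ≤ (j : ℝ) / n := Nat.cast_div_le
  have h3 : ((j / (2 * n - 1) : ℕ) : ℝ) ≤ ((j / n : ℕ) : ℝ) := by exact_mod_cast h
  push_cast
  linarith

theorem abs_aliasHarmonic_le {n : ℕ} (hn : 1 ≤ n) (β x : ℝ) (j : ℕ) (t : ℝ) :
    |aliasHarmonic β n x j t| ≤
      2 * |Real.sin ((2 * n - 1) / 2 * x)| * (1 + (j : ℝ) / n) := by
  rw [aliasHarmonic_eq_mul hn, abs_mul, abs_mul]
  have h1 := abs_sin_nat_mul_le (1 + j / (2 * n - 1)) ((2 * n - 1) / 2 * x)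
  have h2 := Real.abs_sin_le_one (((n : ℝ) + j) * (x - t) - β * Real.pi / 2 -
          ((1 + j / (2 * n - 1) : ℕ) : ℝ) * ((2 * n - 1) / 2 * x))
  have h3 := mul_le_mul_of_nonneg_right (one_add_div_le hn j)
    (abs_nonneg (Real.sin ((2 * n - 1) / 2 * x)))
  rw [abs_neg, abs_two]
  refine (mul_le_of_le_one_right (by positivity) h2).trans ?_
  linarith

theorem continuous_aliasHarmonic (β : ℝ) (n : ℕ) (x : ℝ) (j : ℕ) :
    Continuous (aliasHarmonic β n x j) := by
  unfold aliasHarmonic; fun_prop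

theorem one_sub_abs_le_cos (y : ℝ) : 1 - |y| ≤ Real.cos y := by
  rcases le_total |y| 2 with h | h
  · have h1 := Real.one_sub_sq_div_two_le_cos (x := y)
    have h2 : y ^ 2 = |y| * |y| := by rw [← sq, sq_abs]
    nlinarith [abs_nonneg y]
  · linarith [Real.neg_one_le_cos y]

/-- At a suitable point the harmonics `aliasHarmonic β n x j` with small `j` are all close to their
maximal modulus, with a common sign. -/
theorem exists_le_mul_aliasHarmonic {n : ℕ} (hn : 1 ≤ n) (β x : ℝ) :
    ∃ t σ : ℝ, |σ| ≤ 1 ∧ ∀ j : ℕ, 2 * |Real.sin ((2 * n - 1) / 2 * x)| * (1 - 4 * ((j : ℝ) / n)) ≤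
      σ * aliasHarmonic β n x j t := by
  have hn0 : (0 : ℝ) < n := by exact_mod_cast hn
  set s := Real.sin ((2 * n - 1) / 2 * x) with hs
  -- At t = x - v with n v ≡ ψ modulo 2π, the second sine factor of each harmonic with j < 2n - 1
  -- becomes cos(j v). Reduction modulo 2π makes |v| ≤ π/n, hence |j v| ≤ 4 j/n.
  set ψ : ℝ := (2 * n - 1) / 2 * x + β * Real.pi / 2 + Real.pi / 2 with hψ
  set v : ℝ := (ψ - round (ψ / (2 * Real.pi)) * (2 * Real.pi)) / n with hv
  have hvn : |v| ≤ Real.pi / n := by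
    rw [hv, abs_div, abs_of_pos hn0]
    gcongr
    have h1 := abs_sub_round (ψ / (2 * Real.pi))
    have h2 : ψ - round (ψ / (2 * Real.pi)) * (2 * Real.pi) =
        (ψ / (2 * Real.pi) - round (ψ / (2 * Real.pi))) * (2 * Real.pi) := by
      field_simp
    rw [h2, abs_mul, abs_of_pos Real.two_pi_pos]
    nlinarith [Real.pi_pos]
  obtain ⟨σ, hσ1, hσ⟩ : ∃ σ : ℝ, |σ| ≤ 1 ∧ σ * s = -|s| := by
    rcases le_total 0 s with h | h
    · exact ⟨-1, by norm_num, by rw [abs_of_nonneg h]; ring⟩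
    · exact ⟨1, by norm_num, by rw [abs_of_nonpos h]; ring⟩
  refine ⟨x - v, σ, hσ1, fun j => ?_⟩
  have hj0 : (0 : ℝ) ≤ (j : ℝ) / n := by positivity
  rcases lt_or_ge j (2 * n - 1) with hj | hj
  · rw [aliasHarmonic_eq_mul hn, Nat.div_eq_of_lt hj]
    have e : ((n : ℝ) + j) * (x - (x - v)) - β * Real.pi / 2 -
        ((1 + 0 : ℕ) : ℝ) * ((2 * n - 1) / 2 * x) =
        j * v + Real.pi / 2 - round (ψ / (2 * Real.pi)) * (2 * Real.pi) := by
      have : n * v = ψ - round (ψ / (2 * Real.pi)) * (2 * Real.pi) := by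
        rw [hv]; field_simp
      have h2 : ((n : ℝ) + j) * (x - (x - v)) = n * v + j * v := by ring
      rw [h2, this, hψ]; push_cast; ring
    rw [e, Real.sin_sub_int_mul_two_pi, Real.sin_add_pi_div_two]
    have e2 : σ * (-2 * Real.sin (((1 + 0 : ℕ) : ℝ) * ((2 * n - 1) / 2 * x)) * Real.cos (j * v)) =
        2 * |s| * Real.cos (j * v) := by
      have : ((1 + 0 : ℕ) : ℝ) * ((2 * n - 1) / 2 * x) = (2 * n - 1) / 2 * x := by push_cast; ring
      rw [this, ← hs]
      linear_combination (-2 * Real.cos (j * v)) * hσ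
    rw [e2]
    gcongr
    refine le_trans ?_ (one_sub_abs_le_cos _)
    rw [abs_mul, Nat.abs_cast]
    have h3 : (j : ℝ) * |v| ≤ j * (Real.pi / n) := by gcongr
    have h4 : (j : ℝ) * (Real.pi / n) = Real.pi * (j / n) := by ring
    nlinarith [Real.pi_le_four]
  -- For large j the upper bound for the modulus suffices: 1 - 4u ≤ -(1 + u) once u = j/n ≥ 1.
  · have h1 := abs_aliasHarmonic_le hn β x j (x - v)
    rw [← hs] at h1
    have h2 : |σ * aliasHarmonic β n x j (x - v)| ≤ 2 * |s| * (1 + (j : ℝ) / n) := by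
      rw [abs_mul]
      exact (mul_le_of_le_one_left (abs_nonneg _) hσ1).trans h1
    have h3 := (abs_le.1 h2).1
    refine le_trans ?_ h3
    have h4 : 1 ≤ (j : ℝ) / n := by
      rw [le_div_iff₀ hn0, one_mul]
      exact_mod_cast (show n ≤ j by omega)
    rw [← mul_neg]
    gcongr
    linarith

/-! ### Orthogonality to trigonometric polynomials of order below n -/

theorem integral_cos_mul_eq_zero {k l : ℕ} (hkl : l < k) (c d : ℝ) :
    ∫ t in (-Real.pi)..Real.pi, Real.cos (k * t + c) * Real.cos (l * t + d) = 0 := by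
  have key : ∀ (m : ℤ) (e : ℝ), m ≠ 0 →
      ∫ t in (-Real.pi)..Real.pi, Real.cos (m * t + e) = 0 := by
    intro m e hm
    have hm' : (m : ℝ) ≠ 0 := by exact_mod_cast hm
    rw [intervalIntegral.integral_comp_mul_add (fun y => Real.cos y) hm', integral_cos]
    have : (m : ℝ) * Real.pi + e = m * -Real.pi + e + m * (2 * Real.pi) := by ring
    rw [this, Real.sin_add_int_mul_two_pi, sub_self, smul_zero]
  have e : ∀ t : ℝ, Real.cos (k * t + c) * Real.cos (l * t + d) =
      1 / 2 * Real.cos (((k - l : ℤ) : ℝ) * t + (c - d)) +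
      1 / 2 * Real.cos (((k + l : ℤ) : ℝ) * t + (c + d)) := by
    intro t
    have e1 : ((k - l : ℤ) : ℝ) * t + (c - d) = (k * t + c) - (l * t + d) := by push_cast; ring
    have e2 : ((k + l : ℤ) : ℝ) * t + (c + d) = (k * t + c) + (l * t + d) := by push_cast; ring
    rw [e1, e2, Real.cos_add (k * t + c), Real.cos_sub (k * t + c)]; ring
  simp only [e]
  rw [intervalIntegral.integral_add (Continuous.intervalIntegrable (by fun_prop) _ _)
    (Continuous.intervalIntegrable (by fun_prop) _ _), intervalIntegral.integral_const_mul,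
    intervalIntegral.integral_const_mul, key _ _ (by omega), key _ _ (by omega)]
  simp

theorem integral_cos_mul_trigPoly {n k : ℕ} (hn : 1 ≤ n) (hk : n ≤ k) (c : ℝ) {T : ℝ → ℝ}
    (hT : T ∈ trigPoly (n - 1)) :
    ∫ t in (-Real.pi)..Real.pi, Real.cos (k * t + c) * T t = 0 := by
  obtain ⟨a, b, hab⟩ := hT
  have e : ∀ t : ℝ, Real.cos (k * t + c) * T t = ∑ l ∈ Finset.range (n - 1 + 1),
      (a l * (Real.cos (k * t + c) * Real.cos (l * t + 0)) +
        b l * (Real.cos (k * t + c) * Real.cos (l * t + -(Real.pi / 2)))) := by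
    intro t
    rw [hab, Finset.mul_sum]
    refine Finset.sum_congr rfl fun l _ => ?_
    rw [← sub_eq_add_neg, Real.cos_sub_pi_div_two, add_zero]; ring
  simp only [e]
  rw [intervalIntegral.integral_finsetSum
    fun l _ => Continuous.intervalIntegrable (by fun_prop) _ _]
  refine Finset.sum_eq_zero fun l hl => ?_
  have hl : l < k := by rw [Finset.mem_range] at hl; omega
  rw [intervalIntegral.integral_add (Continuous.intervalIntegrable (by fun_prop) _ _)
    (Continuous.intervalIntegrable (by fun_prop) _ _), intervalIntegral.integral_const_mul,
    intervalIntegral.integral_const_mul, integral_cos_mul_eq_zero hl,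
    integral_cos_mul_eq_zero hl]
  simp

theorem continuous_of_mem_trigPoly {m : ℕ} {T : ℝ → ℝ} (hT : T ∈ trigPoly m) : Continuous T := by
  obtain ⟨a, b, hab⟩ := hT
  rw [funext hab]
  fun_prop

theorem periodic_of_mem_trigPoly {m : ℕ} {T : ℝ → ℝ} (hT : T ∈ trigPoly m) :
    Function.Periodic T (2 * Real.pi) := by
  obtain ⟨a, b, hab⟩ := hT
  intro t
  rw [hab, hab]
  refine Finset.sum_congr rfl fun k _ => ?_
  rw [mul_add, Real.cos_add_nat_mul_two_pi, Real.sin_add_nat_mul_two_pi]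

theorem integral_aliasHarmonic_mul_trigPoly {n : ℕ} (hn : 1 ≤ n) (β x : ℝ) (j : ℕ) {T : ℝ → ℝ}
    (hT : T ∈ trigPoly (n - 1)) :
    ∫ t in (-Real.pi)..Real.pi, aliasHarmonic β n x j t * T t = 0 := by
  have hTc := continuous_of_mem_trigPoly hT
  set c₁ := -(((n : ℝ) + j) * x - β * Real.pi / 2)
  set c₂ := -((((j % (2 * n - 1) : ℕ) : ℝ) - (n - 1)) * x - β * Real.pi / 2)
  have e : ∀ t, aliasHarmonic β n x j t * T t =
      Real.cos ((n + j : ℕ) * t + c₁) * T t - Real.cos ((n + j : ℕ) * t + c₂) * T t := by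
    intro t
    rw [aliasHarmonic, sub_mul, ← Real.cos_neg, ← Real.cos_neg (_ - _ - _)]
    congr 3 <;> simp only [c₁, c₂] <;> push_cast <;> ring
  simp only [e]
  rw [intervalIntegral.integral_sub (Continuous.intervalIntegrable (by fun_prop) _ _)
    (Continuous.intervalIntegrable (by fun_prop) _ _),
    integral_cos_mul_trigPoly hn (by omega) _ hT, integral_cos_mul_trigPoly hn (by omega) _ hT,
    sub_zero]

/-- The error at `x` of the interpolation of `y ↦ P_{α,r,β}(y - t)`. -/
def interpErrorKernel (α r β : ℝ) (n : ℕ) (x t : ℝ) : ℝ :=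
  genPoissonKernel α r β (x - t) - lagrangeInterp n (fun y => genPoissonKernel α r β (y - t)) x

theorem lagrangeInterp_const_mul (n : ℕ) (a : ℝ) (f : ℝ → ℝ) (x : ℝ) :
    lagrangeInterp n (fun y => a * f y) x = a * lagrangeInterp n f x := by
  simp only [lagrangeInterp, Finset.mul_sum]
  refine Finset.sum_congr rfl fun j _ => ?_
  ring

theorem hasSum_lagrangeInterp {n : ℕ} {g : ℕ → ℝ → ℝ} {G : ℝ → ℝ}
    (h : ∀ y, HasSum (fun k => g k y) (G y)) (x : ℝ) :
    HasSum (fun k => lagrangeInterp n (g k) x) (lagrangeInterp n G x) := by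
  simp only [lagrangeInterp]
  exact (hasSum_sum fun j _ => (h (node n j)).mul_right _).mul_left _

/-! ### Series of the error kernel and two-sided bounds for its maximum -/

section Kernel

variable {α r : ℝ} {n : ℕ} (β : ℝ)

theorem summable_exp_neg_succ_rpow (hα : 0 < α) (hn : 1 ≤ n) (hw : 2 < α * r * (n : ℝ) ^ r) :
    Summable (fun k : ℕ => Real.exp (-α * ((k : ℝ) + 1) ^ r)) := by
  rw [← summable_nat_add_iff (n - 1)]
  refine (summable_exp_neg_rpow hα hn hw).congr fun j => ?_
  rw [Nat.cast_add, Nat.cast_sub hn]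
  congr 3; push_cast; ring

theorem hasSum_genPoissonKernel (h : Summable (fun k : ℕ => Real.exp (-α * ((k : ℝ) + 1) ^ r)))
    (t : ℝ) : HasSum (fun k : ℕ => Real.exp (-α * ((k : ℝ) + 1) ^ r) *
      Real.cos (((k : ℝ) + 1) * t - β * Real.pi / 2)) (genPoissonKernel α r β t) := by
  refine Summable.hasSum (Summable.of_norm_bounded h fun k => ?_)
  rw [norm_mul, Real.norm_eq_abs, Real.norm_eq_abs, Real.abs_exp]
  exact mul_le_of_le_one_right (Real.exp_pos _).le (Real.abs_cos_le_one _)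

theorem continuous_genPoissonKernel
    (h : Summable (fun k : ℕ => Real.exp (-α * ((k : ℝ) + 1) ^ r))) :
    Continuous (genPoissonKernel α r β) := by
  refine continuous_tsum (fun k => by fun_prop) h fun k t => ?_
  rw [norm_mul, Real.norm_eq_abs, Real.norm_eq_abs, Real.abs_exp]
  exact mul_le_of_le_one_right (Real.exp_pos _).le (Real.abs_cos_le_one _)

theorem periodic_genPoissonKernel (α r : ℝ) :
    Function.Periodic (genPoissonKernel α r β) (2 * Real.pi) := by
  intro t
  refine tsum_congr fun k => ?_
  have e : ((k : ℝ) + 1) * (t + 2 * Real.pi) - β * Real.pi / 2 =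
      ((k : ℝ) + 1) * t - β * Real.pi / 2 + ((k + 1 : ℕ) : ℝ) * (2 * Real.pi) := by
    push_cast; ring
  rw [e, Real.cos_add_nat_mul_two_pi]

theorem continuous_interpErrorKernel
    (h : Summable (fun k : ℕ => Real.exp (-α * ((k : ℝ) + 1) ^ r))) (n : ℕ) (x : ℝ) :
    Continuous (interpErrorKernel α r β n x) := by
  have := continuous_genPoissonKernel β h
  unfold interpErrorKernel lagrangeInterp
  fun_prop

theorem periodic_interpErrorKernel (α r : ℝ) (n : ℕ) (x : ℝ) :
    Function.Periodic (interpErrorKernel α r β n x) (2 * Real.pi) := by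
  intro t
  have e : ∀ y, genPoissonKernel α r β (y - (t + 2 * Real.pi)) = genPoissonKernel α r β (y - t) := by
    intro y
    rw [← sub_sub, (periodic_genPoissonKernel β α r).sub_eq]
  simp only [interpErrorKernel, e]

theorem hasSum_interpErrorKernel (hα : 0 < α) (hn : 1 ≤ n) (hw : 2 < α * r * (n : ℝ) ^ r)
    (x t : ℝ) : HasSum (fun j : ℕ => Real.exp (-α * ((n : ℝ) + j) ^ r) *
      aliasHarmonic β n x j t) (interpErrorKernel α r β n x t) := by
  have hP := hasSum_genPoissonKernel β (summable_exp_neg_succ_rpow hα hn hw)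
  have h1 := (hP (x - t)).sub (hasSum_lagrangeInterp (n := n) (fun y => hP (y - t)) x)
  -- The summation index k stands for the frequency k + 1, so the first n - 1 terms are exactly the
  -- reproduced harmonics and vanish.
  rw [← hasSum_nat_add_iff' (n - 1)] at h1
  rw [Finset.sum_eq_zero, sub_zero] at h1
  · refine Eq.subst (motive := fun u : ℕ → ℝ => HasSum u _) (funext fun j => ?_) h1
    have e : ((j + (n - 1) : ℕ) : ℝ) + 1 = n + j := by
      rw [Nat.cast_add, Nat.cast_sub hn]; push_cast; ring
    rw [e, lagrangeInterp_const_mul, ← mul_sub, cos_sub_lagrangeInterp_cos hn]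
  · intro k hk
    rw [Finset.mem_range] at hk
    rw [lagrangeInterp_const_mul]
    have e : ∀ y : ℝ, ((k : ℝ) + 1) * (y - t) - β * Real.pi / 2 =
        ((k + 1 : ℕ) : ℝ) * y + (-((k + 1 : ℕ) * t) - β * Real.pi / 2) := by
      intro y; push_cast; ring
    simp only [e]
    rw [lagrangeInterp_cos_nat hn (by omega), sub_self]

theorem abs_interpErrorKernel_le (hα : 0 < α) (hn : 1 ≤ n) (hw : 2 < α * r * (n : ℝ) ^ r)
    (x t : ℝ) : |interpErrorKernel α r β n x t| ≤ 2 * |Real.sin ((2 * n - 1) / 2 * x)| *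
      (Real.exp (-α * (n : ℝ) ^ r) * (1 + n / (α * r * (n : ℝ) ^ r - 2))) := by
  have hs := summable_exp_neg_rpow_mul hα hn hw
  have hb : ∀ j : ℕ, ‖Real.exp (-α * ((n : ℝ) + j) ^ r) * aliasHarmonic β n x j t‖ ≤
      2 * |Real.sin ((2 * n - 1) / 2 * x)| *
        (Real.exp (-α * ((n : ℝ) + j) ^ r) * (1 + (j : ℝ) / n)) := by
    intro j
    rw [norm_mul, Real.norm_eq_abs, Real.norm_eq_abs, Real.abs_exp]
    have := mul_le_mul_of_nonneg_left (abs_aliasHarmonic_le hn β x j t)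
      (Real.exp_pos (-α * ((n : ℝ) + j) ^ r)).le
    linarith
  rw [← (hasSum_interpErrorKernel β hα hn hw x t).tsum_eq, ← Real.norm_eq_abs]
  refine (tsum_of_norm_bounded (hs.1.hasSum.mul_left _) hb).trans ?_
  gcongr
  exact hs.2

theorem exists_le_mul_interpErrorKernel (hα : 0 < α) (hr0 : 0 < r) (hr1 : r < 1) (hn : 1 ≤ n)
    (hw : 2 < α * r * (n : ℝ) ^ r) (x : ℝ) :
    ∃ t σ : ℝ, |σ| ≤ 1 ∧ 2 * |Real.sin ((2 * n - 1) / 2 * x)| *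
      (Real.exp (-α * (n : ℝ) ^ r) * (5 * (n / (α * r * (n : ℝ) ^ r)) -
        4 * (1 + n / (α * r * (n : ℝ) ^ r - 2)))) ≤ σ * interpErrorKernel α r β n x t := by
  obtain ⟨t, σ, hσ, h⟩ := exists_le_mul_aliasHarmonic hn β x
  refine ⟨t, σ, hσ, ?_⟩
  have hs := summable_exp_neg_rpow_mul hα hn hw
  have hs0 := summable_exp_neg_rpow hα hn hw
  have hlow := le_tsum_exp_neg_rpow hα hr0 hr1 hn hw
  -- The identity 1 - 4j/n = 5 - 4(1 + j/n) reduces the sum to the plain one, bounded below, and the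
  -- weighted one, bounded above.
  have hsum : HasSum (fun j : ℕ => 2 * |Real.sin ((2 * n - 1) / 2 * x)| *
      (5 * Real.exp (-α * ((n : ℝ) + j) ^ r) -
        4 * (Real.exp (-α * ((n : ℝ) + j) ^ r) * (1 + (j : ℝ) / n)))) _ :=
    ((hs0.hasSum.mul_left 5).sub (hs.1.hasSum.mul_left 4)).mul_left _
  have hle := hasSum_le (fun j => ?_) hsum
    ((hasSum_interpErrorKernel β hα hn hw x t).mul_left σ)
  · refine le_trans ?_ hle
    gcongr
    linarith [hs.2]
  · have := mul_le_mul_of_nonneg_left (h j) (Real.exp_pos (-α * ((n : ℝ) + j) ^ r)).le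
    linarith

theorem integral_interpErrorKernel_mul_trigPoly (hα : 0 < α) (hn : 1 ≤ n)
    (hw : 2 < α * r * (n : ℝ) ^ r) (x : ℝ) {T : ℝ → ℝ} (hT : T ∈ trigPoly (n - 1)) :
    ∫ t in (-Real.pi)..Real.pi, interpErrorKernel α r β n x t * T t = 0 := by
  have hTc := continuous_of_mem_trigPoly hT
  have hs := (summable_exp_neg_rpow_mul hα hn hw).1.mul_left
    (2 * |Real.sin ((2 * n - 1) / 2 * x)|)
  have key : HasSum (fun j : ℕ => ∫ t in (-Real.pi)..Real.pi,
      Real.exp (-α * ((n : ℝ) + j) ^ r) * aliasHarmonic β n x j t * T t)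
      (∫ t in (-Real.pi)..Real.pi, interpErrorKernel α r β n x t * T t) := by
    refine intervalIntegral.hasSum_integral_of_dominated_convergence
      (fun j t => 2 * |Real.sin ((2 * n - 1) / 2 * x)| *
        (Real.exp (-α * ((n : ℝ) + j) ^ r) * (1 + (j : ℝ) / n)) * |T t|)
      (fun j => ?_) (fun j => ?_) ?_ ?_ ?_
    · exact (((continuous_aliasHarmonic β n x j).const_mul _).mul hTc).aestronglyMeasurable
    · refine Eventually.of_forall fun t _ => ?_
      rw [norm_mul, norm_mul, Real.norm_eq_abs, Real.norm_eq_abs, Real.norm_eq_abs, Real.abs_exp]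
      refine mul_le_mul_of_nonneg_right ?_ (abs_nonneg _)
      have := mul_le_mul_of_nonneg_left (abs_aliasHarmonic_le hn β x j t)
        (Real.exp_pos (-α * ((n : ℝ) + j) ^ r)).le
      linarith
    · exact Eventually.of_forall fun t _ => hs.mul_right _
    · simp only [tsum_mul_right]
      exact Continuous.intervalIntegrable (by fun_prop) _ _
    · exact Eventually.of_forall fun t _ =>
        (hasSum_interpErrorKernel β hα hn hw x t).mul_right _
  have hzero : ∀ j : ℕ, ∫ t in (-Real.pi)..Real.pi,
      Real.exp (-α * ((n : ℝ) + j) ^ r) * aliasHarmonic β n x j t * T t = 0 := by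
    intro j
    simp only [mul_assoc]
    rw [intervalIntegral.integral_const_mul, integral_aliasHarmonic_mul_trigPoly hn β x j hT,
      mul_zero]
  simp only [hzero] at key
  exact key.unique hasSum_zero

end Kernel

/-! ### Periodic integrable functions and best approximation -/

theorem IsPeriodicL1.intervalIntegrable {φ : ℝ → ℝ} (h : IsPeriodicL1 φ) (a b : ℝ) :
    IntervalIntegrable φ volume a b :=
  h.1.intervalIntegrable₀ Real.two_pi_pos.ne' h.2 a b

theorem integral_neg_pi_pi_eq {g : ℝ → ℝ} (hg : Function.Periodic g (2 * Real.pi)) (a : ℝ) :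
    ∫ t in (-Real.pi)..Real.pi, g t = ∫ t in a..a + 2 * Real.pi, g t := by
  rw [← hg.intervalIntegral_add_eq (-Real.pi) a]
  congr 1; ring

theorem const_mem_trigPoly (m : ℕ) (c : ℝ) : (fun _ => c) ∈ trigPoly m := by
  refine ⟨fun k => if k = 0 then c else 0, 0, fun t => ?_⟩
  rw [Finset.sum_eq_single 0] <;> simp +contextual

theorem const_mul_mem_trigPoly {m : ℕ} {T : ℝ → ℝ} (hT : T ∈ trigPoly m) (c : ℝ) :
    (fun t => c * T t) ∈ trigPoly m := by
  obtain ⟨a, b, hab⟩ := hT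
  refine ⟨fun k => c * a k, fun k => c * b k, fun t => ?_⟩
  simp only [hab, Finset.mul_sum]
  exact Finset.sum_congr rfl fun k _ => by ring

theorem bestApproxL1_le {n : ℕ} {T : ℝ → ℝ} (hT : T ∈ trigPoly (n - 1)) (φ : ℝ → ℝ) :
    bestApproxL1 n φ ≤ ∫ t in (0 : ℝ)..(2 * Real.pi), |φ t - T t| := by
  refine ciInf_le (f := fun T : trigPoly (n - 1) =>
    ∫ t in (0 : ℝ)..(2 * Real.pi), |φ t - (T : ℝ → ℝ) t|) ⟨0, ?_⟩ ⟨T, hT⟩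
  rintro _ ⟨S, rfl⟩
  exact intervalIntegral.integral_nonneg Real.two_pi_pos.le fun t _ => abs_nonneg _

theorem le_bestApproxL1 {n : ℕ} {φ : ℝ → ℝ} {c : ℝ}
    (h : ∀ T ∈ trigPoly (n - 1), c ≤ ∫ t in (0 : ℝ)..(2 * Real.pi), |φ t - T t|) :
    c ≤ bestApproxL1 n φ := by
  have : Nonempty (trigPoly (n - 1)) := ⟨⟨_, const_mem_trigPoly _ 0⟩⟩
  exact le_ciInf fun T => h T T.2

theorem bestApproxL1_nonneg (n : ℕ) (φ : ℝ → ℝ) : 0 ≤ bestApproxL1 n φ :=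
  le_bestApproxL1 fun _ _ =>
    intervalIntegral.integral_nonneg Real.two_pi_pos.le fun _ _ => abs_nonneg _

theorem bestApproxL1_const_mul (n : ℕ) (φ : ℝ → ℝ) {c : ℝ} (hc : 0 < c) :
    bestApproxL1 n (fun t => c * φ t) = c * bestApproxL1 n φ := by
  have key : ∀ (ψ : ℝ → ℝ) (b : ℝ), 0 < b →
      bestApproxL1 n (fun t => b * ψ t) ≤ b * bestApproxL1 n ψ := by
    intro ψ b hb
    rw [← div_le_iff₀' hb]
    refine le_bestApproxL1 fun T hT => ?_
    rw [div_le_iff₀' hb, ← intervalIntegral.integral_const_mul]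
    refine (bestApproxL1_le (const_mul_mem_trigPoly hT b) _).trans_eq ?_
    congr 1 with t
    rw [← mul_sub, abs_mul, abs_of_pos hb]
  refine (key φ c hc).antisymm ?_
  have h := key (fun t => c * φ t) c⁻¹ (inv_pos.2 hc)
  simp only [inv_mul_cancel_left₀ hc.ne'] at h
  rwa [inv_mul_eq_div, le_div_iff₀' hc] at h

/-! ### Integral representation and upper bound of the interpolation error -/

section Error

variable {α r β : ℝ} {n : ℕ}

theorem IsGenDeriv.sub_lagrangeInterp {f φ : ℝ → ℝ} (hφ : IsGenDeriv α r β f φ) (hα : 0 < α)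
    (hn : 1 ≤ n) (hw : 2 < α * r * (n : ℝ) ^ r) (x : ℝ) :
    f x - lagrangeInterp n f x =
      1 / Real.pi * ∫ t in (-Real.pi)..Real.pi, interpErrorKernel α r β n x t * φ t := by
  obtain ⟨a₀, hf⟩ := hφ.repr
  have hP := continuous_genPoissonKernel β (summable_exp_neg_succ_rpow hα hn hw)
  have hi : ∀ y, IntervalIntegrable (fun t => genPoissonKernel α r β (y - t) * φ t) volume
      (-Real.pi) Real.pi := fun y =>
    (hφ.memL1.intervalIntegrable _ _).continuousOn_mul
      (Continuous.continuousOn (by fun_prop))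
  have hconst : lagrangeInterp n (fun _ => a₀ / 2) x = a₀ / 2 := by
    have h := lagrangeInterp_cos_nat hn (k := 0) (by omega) 0 x
    have h2 := lagrangeInterp_const_mul n (a₀ / 2) (fun y => Real.cos ((0 : ℕ) * y + 0)) x
    rw [h] at h2
    simpa using h2
  have hadd : lagrangeInterp n f x = lagrangeInterp n (fun _ => a₀ / 2) x +
      1 / Real.pi * lagrangeInterp n
        (fun y => ∫ t in (-Real.pi)..Real.pi, genPoissonKernel α r β (y - t) * φ t) x := by
    simp only [lagrangeInterp, hf, Finset.mul_sum, ← Finset.sum_add_distrib]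
    exact Finset.sum_congr rfl fun j _ => by ring
  have hint : ∫ t in (-Real.pi)..Real.pi,
      lagrangeInterp n (fun y => genPoissonKernel α r β (y - t)) x * φ t =
      lagrangeInterp n
        (fun y => ∫ t in (-Real.pi)..Real.pi, genPoissonKernel α r β (y - t) * φ t) x := by
    have e : ∀ t, lagrangeInterp n (fun y => genPoissonKernel α r β (y - t)) x * φ t =
        2 / (2 * n - 1) * ∑ k ∈ Finset.range (2 * n - 1),
          dirichletKernel (n - 1) (x - node n k) *
            (genPoissonKernel α r β (node n k - t) * φ t) := by
      intro t
      simp only [lagrangeInterp, Finset.mul_sum, Finset.sum_mul]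
      exact Finset.sum_congr rfl fun j _ => by ring
    simp only [e]
    rw [intervalIntegral.integral_const_mul,
      intervalIntegral.integral_finsetSum fun j _ => (hi _).const_mul _]
    simp only [lagrangeInterp, intervalIntegral.integral_const_mul]
    congr 1
    exact Finset.sum_congr rfl fun j _ => mul_comm _ _
  have hL : Continuous fun t => lagrangeInterp n (fun y => genPoissonKernel α r β (y - t)) x := by
    unfold lagrangeInterp; fun_prop
  simp only [interpErrorKernel, sub_mul]
  rw [intervalIntegral.integral_sub (hi x)
    ((hφ.memL1.intervalIntegrable _ _).continuousOn_mul hL.continuousOn), hint, hadd, hconst, hf]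
  ring

theorem IsGenDeriv.abs_sub_lagrangeInterp_le {f φ : ℝ → ℝ} (hφ : IsGenDeriv α r β f φ)
    (hα : 0 < α) (hn : 1 ≤ n) (hw : 2 < α * r * (n : ℝ) ^ r) (x : ℝ) :
    |f x - lagrangeInterp n f x| ≤ 1 / Real.pi * (2 * |Real.sin ((2 * n - 1) / 2 * x)| *
      (Real.exp (-α * (n : ℝ) ^ r) * (1 + n / (α * r * (n : ℝ) ^ r - 2)))) *
      bestApproxL1 n φ := by
  have hK := continuous_interpErrorKernel β (summable_exp_neg_succ_rpow hα hn hw) n x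
  set B := 2 * |Real.sin ((2 * n - 1) / 2 * x)| *
      (Real.exp (-α * (n : ℝ) ^ r) * (1 + n / (α * r * (n : ℝ) ^ r - 2))) with hB
  have hB0 : 0 ≤ B := (abs_nonneg _).trans (abs_interpErrorKernel_le β hα hn hw x 0)
  have key : ∀ T ∈ trigPoly (n - 1), |f x - lagrangeInterp n f x| ≤
      1 / Real.pi * B * ∫ t in (0 : ℝ)..(2 * Real.pi), |φ t - T t| := by
    intro T hT
    have hTc := continuous_of_mem_trigPoly hT
    have hφi := hφ.memL1.intervalIntegrable (-Real.pi) Real.pi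
    have hTi : IntervalIntegrable T volume (-Real.pi) Real.pi := hTc.intervalIntegrable _ _
    have h1 : ∫ t in (-Real.pi)..Real.pi, interpErrorKernel α r β n x t * φ t =
        ∫ t in (-Real.pi)..Real.pi, interpErrorKernel α r β n x t * (φ t - T t) := by
      simp only [mul_sub]
      rw [intervalIntegral.integral_sub (hφi.continuousOn_mul hK.continuousOn)
        (hTi.continuousOn_mul hK.continuousOn),
        integral_interpErrorKernel_mul_trigPoly β hα hn hw x hT, sub_zero]
    have hper : Function.Periodic (fun t => |φ t - T t|) (2 * Real.pi) := by
      intro t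
      simp only [hφ.memL1.1 t, periodic_of_mem_trigPoly hT t]
    have h2 := integral_neg_pi_pi_eq hper 0
    rw [zero_add] at h2
    rw [hφ.sub_lagrangeInterp hα hn hw, h1, abs_mul, abs_of_pos (by positivity), mul_assoc, ← h2,
      ← intervalIntegral.integral_const_mul]
    gcongr
    refine (intervalIntegral.abs_integral_le_integral_abs (by linarith [Real.pi_pos])).trans ?_
    refine intervalIntegral.integral_mono_on (by linarith [Real.pi_pos])
      ((hφi.sub hTi).continuousOn_mul hK.continuousOn).abs ((hφi.sub hTi).abs.const_mul B)
      fun t _ => ?_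
    rw [abs_mul]
    gcongr
    exact abs_interpErrorKernel_le β hα hn hw x t
  -- Passing to the infimum over T divides by B, which is zero when x is a zero of the sine factor.
  rcases hB0.eq_or_lt with h0 | h0
  · have := key _ (const_mem_trigPoly _ 0)
    rw [← h0] at this ⊢
    simpa using this
  · have hc : 0 < 1 / Real.pi * B := by positivity
    rw [← div_le_iff₀' hc]
    refine le_bestApproxL1 fun T hT => ?_
    rw [div_le_iff₀' hc]
    exact key T hT

end Error

/-! ### Functions with nearly extremal interpolation error -/

section Extremal

variable {α r β : ℝ} {n : ℕ}

theorem exists_isGenDeriv (α r β : ℝ) {Φ : ℝ → ℝ} (h : IsPeriodicL1 Φ)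
    (h0 : ∫ t in (-Real.pi)..Real.pi, Φ t = 0) : ∃ F, IsGenDeriv α r β F Φ :=
  ⟨_, h, h0, 0, fun _ => rfl⟩

/-- The sets {cos(t - t₀) > c}, c < 1, are periodic neighbourhoods shrinking to t₀ modulo 2π; they
support the bumps below. -/
theorem exists_cos_gt_imp_lt {g : ℝ → ℝ} (hg : Continuous g)
    (hper : Function.Periodic g (2 * Real.pi)) {κ t₀ : ℝ} (h : κ < g t₀) :
    ∃ c < 1, ∀ t, c < Real.cos (t - t₀) → κ < g t := by
  obtain ⟨δ, hδ, hball⟩ := Metric.mem_nhds_iff.1 (hg.continuousAt.eventually (lt_mem_nhds h))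
  have hδ' : 0 < min δ Real.pi := lt_min hδ Real.pi_pos
  refine ⟨Real.cos (min δ Real.pi), ?_, fun t ht => ?_⟩
  · rw [← Real.cos_zero]
    exact Real.cos_lt_cos_of_nonneg_of_le_pi le_rfl (min_le_right _ _) hδ'
  · set m := round ((t - t₀) / (2 * Real.pi)) with hm
    set s := t - t₀ - m * (2 * Real.pi) with hs
    have hsπ : |s| ≤ Real.pi := by
      have h1 := abs_sub_round ((t - t₀) / (2 * Real.pi))
      have h2 : s = ((t - t₀) / (2 * Real.pi) - m) * (2 * Real.pi) := by
        rw [hs]; field_simp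
      rw [h2, abs_mul, abs_of_pos Real.two_pi_pos]
      nlinarith [Real.pi_pos]
    have hcos : Real.cos |s| = Real.cos (t - t₀) := by
      rw [Real.cos_abs, hs, Real.cos_sub_int_mul_two_pi]
    have hlt : |s| < min δ Real.pi := by
      by_contra! hle
      have := Real.cos_le_cos_of_nonneg_of_le_pi hδ'.le hsπ hle
      linarith
    have hmem : t - m * (2 * Real.pi) ∈ Metric.ball t₀ δ := by
      rw [Metric.mem_ball, Real.dist_eq]
      have : t - m * (2 * Real.pi) - t₀ = s := by rw [hs]; ring
      rw [this]
      exact hlt.trans_le (min_le_left _ _)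
    have := hball hmem
    simpa only [Set.mem_ofPred_eq, hper.sub_int_mul_eq] using this

/-- Take a multiple of b - μ, with b a nonnegative bump supported where σK > κ and μ its mean. Since
K is orthogonal to constants, removing μ does not change the error, which is at least κ/π times the
integral I of b. Approximation by -μ gives E_n(b - μ) ≤ I. -/
theorem exists_isGenDeriv_le_abs_sub_lagrangeInterp (hα : 0 < α) (hn : 1 ≤ n)
    (hw : 2 < α * r * (n : ℝ) ^ r) {x t₀ σ κ E : ℝ} (hσ : |σ| ≤ 1) (hκ : 0 < κ)
    (hK : κ < σ * interpErrorKernel α r β n x t₀) (hE : 0 < E) :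
    ∃ F Φ, IsGenDeriv α r β F Φ ∧ bestApproxL1 n Φ = E ∧
      1 / Real.pi * κ * E ≤ |F x - lagrangeInterp n F x| := by
  have hKc := continuous_interpErrorKernel β (summable_exp_neg_succ_rpow hα hn hw) n x
  have hKp := periodic_interpErrorKernel β α r n x
  have hπ := Real.pi_pos
  obtain ⟨c, hc1, hc⟩ := exists_cos_gt_imp_lt (g := fun t => σ * interpErrorKernel α r β n x t)
    (by fun_prop) (fun t => by simp only [hKp t]) hK
  set b : ℝ → ℝ := fun t => max 0 (Real.cos (t - t₀) - c) with hb
  have hbc : Continuous b := by fun_prop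
  have hb0 : ∀ t, 0 ≤ b t := fun t => le_max_left _ _
  have hbp : Function.Periodic b (2 * Real.pi) := by
    intro t
    simp only [hb, add_sub_right_comm, Real.cos_add_two_pi]
  set I := ∫ t in (-Real.pi)..Real.pi, b t with hI
  have hI0 : 0 < I := by
    rw [hI, integral_neg_pi_pi_eq hbp t₀]
    refine intervalIntegral.integral_pos (by linarith) hbc.continuousOn (fun t _ => hb0 t)
      ⟨t₀, ⟨le_rfl, by linarith⟩, ?_⟩
    simp only [hb, sub_self, Real.cos_zero]
    exact lt_max_of_lt_right (by linarith)
  set μ := I / (2 * Real.pi) with hμ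
  have horth : ∀ a : ℝ, ∫ t in (-Real.pi)..Real.pi, a * (b t - μ) = 0 := by
    intro a
    rw [intervalIntegral.integral_const_mul,
      intervalIntegral.integral_sub (hbc.intervalIntegrable _ _) (by simp), ← hI,
      intervalIntegral.integral_const, hμ, smul_eq_mul]
    field_simp; ring
  have hL1 : ∀ a : ℝ, IsPeriodicL1 (fun t => a * (b t - μ)) := fun a =>
    ⟨fun t => by simp only [hbp t], Continuous.intervalIntegrable (by fun_prop) _ _⟩
  have herr : ∀ (a : ℝ) (F : ℝ → ℝ), 0 < a → IsGenDeriv α r β F (fun t => a * (b t - μ)) →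
      1 / Real.pi * κ * (a * I) ≤ |F x - lagrangeInterp n F x| := by
    intro a F ha hF
    rw [hF.sub_lagrangeInterp hα hn hw]
    have e : ∫ t in (-Real.pi)..Real.pi, interpErrorKernel α r β n x t * (a * (b t - μ)) =
        a * ∫ t in (-Real.pi)..Real.pi, interpErrorKernel α r β n x t * b t := by
      have h1 := integral_interpErrorKernel_mul_trigPoly β hα hn hw x
        (const_mem_trigPoly (n - 1) (a * μ))
      have e2 : ∀ t, interpErrorKernel α r β n x t * (a * (b t - μ)) =
          a * (interpErrorKernel α r β n x t * b t) - interpErrorKernel α r β n x t * (a * μ) :=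
        fun t => by ring
      simp only [e2]
      rw [intervalIntegral.integral_sub (Continuous.intervalIntegrable (by fun_prop) _ _)
        (Continuous.intervalIntegrable (by fun_prop) _ _), h1, sub_zero,
        intervalIntegral.integral_const_mul]
    have h2 : κ * I ≤ σ * ∫ t in (-Real.pi)..Real.pi, interpErrorKernel α r β n x t * b t := by
      rw [hI, ← intervalIntegral.integral_const_mul, ← intervalIntegral.integral_const_mul]
      refine intervalIntegral.integral_mono_on (by linarith)
        (Continuous.intervalIntegrable (by fun_prop) _ _)
        (Continuous.intervalIntegrable (by fun_prop) _ _) fun t _ => ?_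
      rw [← mul_assoc]
      rcases le_or_gt (Real.cos (t - t₀)) c with h | h
      · have : b t = 0 := max_eq_left (by linarith)
        rw [this, mul_zero, mul_zero]
      · exact mul_le_mul_of_nonneg_right (hc t h).le (hb0 t)
    have h3 : κ * I ≤ |∫ t in (-Real.pi)..Real.pi, interpErrorKernel α r β n x t * b t| := by
      refine (h2.trans (le_abs_self _)).trans ?_
      rw [abs_mul]
      exact mul_le_of_le_one_left (abs_nonneg _) hσ
    rw [e, abs_mul, abs_mul, abs_of_pos ha, abs_of_pos (by positivity : 0 < 1 / Real.pi)]
    calc 1 / Real.pi * κ * (a * I) = 1 / Real.pi * (a * (κ * I)) := by ring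
      _ ≤ _ := by gcongr
  set E₀ := bestApproxL1 n (fun t => b t - μ) with hE₀
  have hE₀I : E₀ ≤ I := by
    refine (bestApproxL1_le (const_mem_trigPoly (n - 1) (-μ)) _).trans_eq ?_
    have h2 := integral_neg_pi_pi_eq hbp 0
    rw [zero_add] at h2
    rw [hI, h2]
    congr 1 with t
    rw [sub_neg_eq_add, sub_add_cancel, abs_of_nonneg (hb0 t)]
  -- If E₀ were zero, the upper bound would force a zero error, against the lower bound just
  -- obtained.
  have hE₀0 : 0 < E₀ := by
    obtain ⟨F, hF⟩ := exists_isGenDeriv α r β (hL1 1) (horth 1)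
    have h1 := herr 1 F one_pos hF
    have h2 := hF.abs_sub_lagrangeInterp_le hα hn hw x
    simp only [one_mul] at h1 h2
    refine (bestApproxL1_nonneg n _).lt_of_ne fun h => ?_
    rw [← h, mul_zero] at h2
    have : 0 < 1 / Real.pi * κ * I := by positivity
    linarith
  obtain ⟨F, hF⟩ := exists_isGenDeriv α r β (hL1 (E / E₀)) (horth (E / E₀))
  refine ⟨F, _, hF, ?_, ?_⟩
  · rw [bestApproxL1_const_mul n _ (div_pos hE hE₀0), ← hE₀, div_mul_cancel₀ _ hE₀0.ne']
  · refine le_trans ?_ (herr _ F (div_pos hE hE₀0) hF)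
    have : E ≤ E / E₀ * I := by
      rw [div_mul_eq_mul_div, le_div_iff₀ hE₀0]
      gcongr
    gcongr

end Extremal

/-! ### The range of admissible orders -/

theorem bounds_of_nStar_le {α r : ℝ} (hα : 0 < α) (hr0 : 0 < r) (hr1 : r < 1) {n : ℕ}
    (hn : nStar α r ≤ n) :
    1 ≤ n ∧ 28 ≤ α * r * (n : ℝ) ^ r ∧ 14 * (α * r * (n : ℝ) ^ r) ≤ n := by
  obtain ⟨h1, h2⟩ := (nStar_isLeast (α := α) hr0 hr1).1
  set m := nStar α r
  have hm1 : (1 : ℝ) ≤ m := by exact_mod_cast h1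
  have hm0 : (0 : ℝ) < m := by linarith
  have hmn : (m : ℝ) ≤ n := by exact_mod_cast hn
  have hπ := Real.pi_gt_three
  have hexp : Real.exp 1 < 3 := Real.exp_one_lt_d9.trans (by norm_num)
  have hpow : ∀ k : ℝ, 0 < k → α * r / k ^ (1 - r) = α * r * k ^ r / k := by
    intro k hk
    rw [Real.rpow_sub hk, Real.rpow_one]
    have := Real.rpow_pos_of_pos hk r
    field_simp
  have hw0 : 0 < α * r * (m : ℝ) ^ r := by positivity
  have hlog1 : 1 ≤ Real.log (Real.pi * m) := by
    rw [Real.le_log_iff_exp_le (by positivity)]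
    nlinarith
  have hA : Real.log (Real.pi * m) / (α * r * (m : ℝ) ^ r) ≤ 1 / 14 := by
    have : 0 ≤ α * r / (m : ℝ) ^ (1 - r) := by positivity
    linarith
  have hB : α * r / (m : ℝ) ^ (1 - r) ≤ 1 / 14 := by
    have : 0 ≤ Real.log (Real.pi * m) / (α * r * (m : ℝ) ^ r) := by positivity
    linarith
  rw [div_le_iff₀ hw0] at hA
  have hB' := hB
  -- Bootstrap, with w taken at m: log(πm) ≥ 1 gives w ≥ 14, so m ≥ 14w ≥ 196, so log(πm) ≥ 2 and w
  -- ≥ 28. The bounds pass from m to n by monotonicity of the powers.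
  rw [hpow _ hm0, div_le_iff₀ hm0] at hB'
  have hlog2 : 2 ≤ Real.log (Real.pi * m) := by
    rw [Real.le_log_iff_exp_le (by positivity), show (2 : ℝ) = 1 + 1 by norm_num, Real.exp_add]
    nlinarith [Real.exp_pos 1]
  have hmono : (m : ℝ) ^ r ≤ (n : ℝ) ^ r := Real.rpow_le_rpow hm0.le hmn hr0.le
  have hmono2 : (m : ℝ) ^ (1 - r) ≤ (n : ℝ) ^ (1 - r) :=
    Real.rpow_le_rpow hm0.le hmn (by linarith)
  have hαr : 0 < α * r := by positivity
  refine ⟨h1.trans hn, ?_, ?_⟩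
  · have := mul_le_mul_of_nonneg_left hmono hαr.le
    linarith
  · have h3 : α * r / (n : ℝ) ^ (1 - r) ≤ α * r / (m : ℝ) ^ (1 - r) := by gcongr
    have hn0 : (0 : ℝ) < n := by linarith
    have h4 := h3.trans hB
    rw [hpow _ hn0, div_le_iff₀ hn0] at h4
    linarith

/-- 1/(w-2) - 1/w = (2/w²) · w/(w-2), and w/(w-2) ≤ 28/26 for w ≥ 28. -/
theorem div_sub_two_le {ν w : ℝ} (hν : 0 ≤ ν) (hw : 28 ≤ w) :
    ν / (w - 2) ≤ ν / w + 28 / 13 * (ν / w ^ 2) := by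
  have h : ν / w + 28 / 13 * (ν / w ^ 2) = ν * ((w + 28 / 13) / w ^ 2) := by
    field_simp
  rw [h, div_eq_mul_inv]
  gcongr
  rw [inv_eq_one_div, div_le_div_iff₀ (by linarith) (by positivity)]
  nlinarith

end

/-! ### Choice of the extremal function and of γ -/

theorem theorem2 (α r β : ℝ) (hα : 0 < α) (hr0 : 0 < r) (hr1 : r < 1)
    (n : ℕ) (hn : nStar α r ≤ n) (x : ℝ)
    (f : ℝ → ℝ) (hf : f ∈ poissonClassL1 α r β)
    (φ : ℝ → ℝ) (hφ : IsGenDeriv α r β f φ) :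
    ∃ γ : ℝ, |γ| < 20 * Real.pi ^ 4 ∧
      |f x - lagrangeInterp n f x| ≤
        2 * Real.exp (-α * (n : ℝ) ^ r) * (n : ℝ) ^ (1 - r) *
          |Real.sin ((2 * (n : ℝ) - 1) / 2 * x)| *
          (1 / (Real.pi * α * r) +
            γ * (1 / (α * r) ^ 2 * (1 / (n : ℝ) ^ r) + 1 / (n : ℝ) ^ (1 - r))) *
          bestApproxL1 n φ ∧
      ∃ F ∈ poissonClassL1 α r β, ∃ Φ : ℝ → ℝ, IsGenDeriv α r β F Φ ∧
        bestApproxL1 n Φ = bestApproxL1 n φ ∧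
        |F x - lagrangeInterp n F x| =
          2 * Real.exp (-α * (n : ℝ) ^ r) * (n : ℝ) ^ (1 - r) *
            |Real.sin ((2 * (n : ℝ) - 1) / 2 * x)| *
            (1 / (Real.pi * α * r) +
              γ * (1 / (α * r) ^ 2 * (1 / (n : ℝ) ^ r) + 1 / (n : ℝ) ^ (1 - r))) *
            bestApproxL1 n φ := by
  obtain ⟨hn1, hw28, hwn⟩ := bounds_of_nStar_le hα hr0 hr1 hn
  have hw : 2 < α * r * (n : ℝ) ^ r := by linarith
  have hπ := Real.pi_gt_three
  have hπ4 : 81 < Real.pi ^ 4 := by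
    have : (3 : ℝ) ^ 4 < Real.pi ^ 4 := by gcongr
    linarith
  have hn0 : (0 : ℝ) < n := by exact_mod_cast hn1
  have hfle := hφ.abs_sub_lagrangeInterp_le hα hn1 hw x
  -- If the sine factor or the best approximation vanishes, both sides are zero, and γ = 0, F = f
  -- serve.
  rcases (mul_nonneg (abs_nonneg (Real.sin ((2 * (n : ℝ) - 1) / 2 * x)))
    (bestApproxL1_nonneg n φ)).eq_or_lt with h0 | h0
  · have hzero : |f x - lagrangeInterp n f x| = 0 := by
      refine le_antisymm (hfle.trans_eq ?_) (abs_nonneg _)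
      rw [mul_comm] at h0
      linear_combination (-(1 / Real.pi * 2 * (Real.exp (-α * (n : ℝ) ^ r) *
        (1 + n / (α * r * (n : ℝ) ^ r - 2))))) * h0
    have hrhs : ∀ a b : ℝ, a * |Real.sin ((2 * (n : ℝ) - 1) / 2 * x)| * b * bestApproxL1 n φ = 0 := by
      intro a b
      linear_combination (-(a * b)) * h0
    refine ⟨0, by rw [abs_zero]; positivity, ?_, f, hf, φ, hφ, rfl, ?_⟩
    · rw [hrhs, hzero]
    · rw [hrhs, hzero]
  have hE0 : 0 < bestApproxL1 n φ := pos_of_mul_pos_right h0 (abs_nonneg _)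
  have hs0 : 0 < |Real.sin ((2 * (n : ℝ) - 1) / 2 * x)| :=
    pos_of_mul_pos_left h0 (bestApproxL1_nonneg n φ)
  set E := bestApproxL1 n φ
  set s := |Real.sin ((2 * (n : ℝ) - 1) / 2 * x)| with hs
  set w := α * r * (n : ℝ) ^ r with hwdef
  have hw0 : 0 < w := by linarith
  have hdiv := div_sub_two_le hn0.le hw28
  have hνw : 14 ≤ n / w := by rw [le_div_iff₀ hw0]; linarith
  have hνw2 : n / w ^ 2 ≤ n / w / 28 := by
    rw [div_div]
    gcongr
    nlinarith
  obtain ⟨t₀, σ, hσ, hK⟩ := exists_le_mul_interpErrorKernel β hα hr0 hr1 hn1 hw x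
  set e := Real.exp (-α * (n : ℝ) ^ r)
  have he : 0 < e := Real.exp_pos _
  -- The final -1 provides the strict inequality required for the bump. With n/w ≥ 14 and n/(w-2) ≤
  -- (14/13) n/w, k stays positive.
  set k := 5 * (n / w) - 4 * (1 + n / (w - 2)) - 1 with hk
  have hk0 : 0 < k := by rw [hk]; linarith
  have hκK : 2 * s * (e * k) < σ * interpErrorKernel α r β n x t₀ := by
    refine lt_of_lt_of_le ?_ hK
    gcongr
    rw [hk]; linarith
  obtain ⟨F, Φ, hF, hΦE, hlow, hge⟩ : ∃ F Φ, IsGenDeriv α r β F Φ ∧ bestApproxL1 n Φ = E ∧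
      1 / Real.pi * (2 * s * (e * k)) * E ≤ |F x - lagrangeInterp n F x| ∧
      |f x - lagrangeInterp n f x| ≤ |F x - lagrangeInterp n F x| := by
    -- Either f already reaches the lower bound and serves as F, or a bump function exceeds it.
    by_cases h : 1 / Real.pi * (2 * s * (e * k)) * E ≤ |f x - lagrangeInterp n f x|
    · exact ⟨f, φ, hφ, rfl, h, le_rfl⟩
    · obtain ⟨F, Φ, hF, hΦ, hl⟩ :=
        exists_isGenDeriv_le_abs_sub_lagrangeInterp hα hn1 hw hσ (by positivity) hκK hE0
      exact ⟨F, Φ, hF, hΦ, hl, (not_le.1 h).le.trans hl⟩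
  have hup := hF.abs_sub_lagrangeInterp_le hα hn1 hw x
  rw [hΦE] at hup
  set V := |F x - lagrangeInterp n F x|
  -- This is n^{1-r} times the factor of γ in the statement; likewise n/(wπ) is n^{1-r}/(παr).
  set y := (n : ℝ) / w ^ 2 + 1 with hy
  have hy0 : 0 < y := by positivity
  set γ := (V / (2 * e * s * E) - n / w / Real.pi) / y with hγ
  have hV : V = 2 * e * s * (n / w / Real.pi + γ * y) * E := by
    rw [hγ]; field_simp; ring
  have hEq : 2 * e * (n : ℝ) ^ (1 - r) * s * (1 / (Real.pi * α * r) +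
      γ * (1 / (α * r) ^ 2 * (1 / (n : ℝ) ^ r) + 1 / (n : ℝ) ^ (1 - r))) * E = V := by
    have hnr : 0 < (n : ℝ) ^ r := Real.rpow_pos_of_pos hn0 r
    rw [hV, hy, hwdef, Real.rpow_sub hn0, Real.rpow_one]
    field_simp
  have hc : 0 < 2 * e * s * E := by positivity
  have hu : n / w / Real.pi + γ * y ≤ 1 / Real.pi * (1 + n / (w - 2)) := by
    refine le_of_mul_le_mul_left (a := 2 * e * s * E) ?_ hc
    rw [hV] at hup
    linarith
  have hl : 1 / Real.pi * k ≤ n / w / Real.pi + γ * y := by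
    refine le_of_mul_le_mul_left (a := 2 * e * s * E) ?_ hc
    rw [hV] at hlow
    linarith
  have hπ0 : 0 < Real.pi := Real.pi_pos
  have hu' : Real.pi * γ * y ≤ 1 + n / (w - 2) - n / w := by
    have := mul_le_mul_of_nonneg_left hu hπ0.le
    rw [mul_add, mul_div_cancel₀ _ hπ0.ne', ← mul_assoc, ← mul_assoc, mul_one_div_cancel hπ0.ne',
      one_mul] at this
    linarith
  have hl' : k - n / w ≤ Real.pi * γ * y := by
    have := mul_le_mul_of_nonneg_left hl hπ0.le
    rw [mul_add, mul_div_cancel₀ _ hπ0.ne', ← mul_assoc, ← mul_assoc, mul_one_div_cancel hπ0.ne',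
      one_mul] at this
    linarith
  have hq0 : 0 ≤ n / w ^ 2 := by positivity
  -- By the bound for n/(w-2), πγy lies between -5 - (112/13) n/w² and 1 + (28/13) n/w², hence
  -- within ±16y.
  have h1 : Real.pi * γ ≤ 16 := by
    refine le_of_mul_le_mul_right (a := y) ?_ hy0
    linarith
  have h2 : -16 ≤ Real.pi * γ := by
    refine le_of_mul_le_mul_right (a := y) ?_ hy0
    linarith
  refine ⟨γ, ?_, ?_, F, ⟨Φ, hF⟩, Φ, hF, hΦE, hEq.symm⟩
  · have h3 : |Real.pi * γ| ≤ 16 := abs_le.2 ⟨h2, h1⟩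
    rw [abs_mul, abs_of_pos hπ0] at h3
    have h4 := (le_mul_of_one_le_left (abs_nonneg γ) (by linarith : 1 ≤ Real.pi)).trans h3
    linarith
  · rw [hEq]; exact hge
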